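/- Let $N,D,C,r\in\mathbb N$, $0<p\le 1$, $\sigma>0$, $\varepsilon\ge 0$, $\mathcal Y=\{1,\dots,C\}$, and set $\Delta=1-p^{r}$. For $X\in\mathbb R^{N\times D}$ with rows $x_1,\dots,x_N$, the Gaussian hierarchical smoothing distribution $\Psi_X$ on $\mathbb R^{N\times D}\times\{0,1\}^N$ is the law of $(W,\tau)$, where $\tau_1,\dots,\tau_N$ are i.i.d. $\mathrm{Ber}(p)$ and, given $\tau$, the rows $w_i$ of $W$ are independent with $w_i\sim\mathcal N(x_i,\sigma^2 I)$ if $\tau_i=1$ and $w_i=x_i$ if $\tau_i=0$. For a measurable classifier $f:\mathbb R^{N\times D}\times\{0,1\}^N\to\mathcal Y$ let $p_{X,y}=\Pr_{Z\sim\Psi_X}[f(Z)=y]$, and let $g$ be a smoothed classifier, $g(X)\in\arg\max_{y\in\mathcal Y}p_{X,y}$ for every $X$, with ties broken arbitrarily. Let $$\mathcal B(X)=\Big\{\tilde X\in\mathbb R^{N\times D} : |\{i: x_i\ne\tilde x_i\}|\le r,\ \|X-\tilde X\|_F\le\varepsilon\Big\},$$ where $\|\cdot\|_F$ is the Frobenius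 norm, and let $$\overline{p_{\tilde X,y}}=\max_{h}\Pr_{Z\sim\Psi_{\tilde X}}[h(Z)=y]\quad\text{subject to}\quad \Pr_{Z\sim\Psi_X}[h(Z)=y]=p_{X,y},$$ where $h$ ranges over all measurable classifiers $h:\mathbb R^{N\times D}\times\{0,1\}^N\to\mathcal Y$. Let $\Phi$ be the standard normal cumulative distribution function, with $\Phi(-\infty)=0$ and $\Phi(+\infty)=1$, and let $\Phi^{-1}$ be its inverse on $(0,1)$, with $\Phi^{-1}(t)=-\infty$ for $t\le 0$ and $\Phi^{-1}(t)=+\infty$ for $t\ge 1$. Fix $f$ and $X$. (i) Suppose that $\varepsilon>0$, $1\le r\le N$ and $D\ge 1$. If $y\in\mathcal Y$ satisfies $p_{X,y}\le 1-\Delta$, then the maximum defining $\overline{p_{\tilde X,y}}$ is attained for every $\tilde X\in\mathcal B(X)$, and $$\max_{\tilde X\in\mathcal B(X)}\overline{p_{\tilde X,y}}=\Phi\Big(\Phi^{-1}\Big(\frac{p_{X,y}}{1-\Delta}\Big)+\frac{\varepsilon}{\sigma}\Big)(1-\Delta)+\Delta,$$ where the maximum over $\mathcal B(X)$ is attained.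 (ii) Let $y^*=g(X)$. If for every $y\ne y^*$ $$\Phi\Big(\Phi^{-1}\Big(\frac{p_{X,y^*}-\Delta}{1-\Delta}\Big)-\frac{\varepsilon}{\sigma}\Big)>\Phi\Big(\Phi^{-1}\Big(\frac{p_{X,y}}{1-\Delta}\Big)+\frac{\varepsilon}{\sigma}\Big)+\frac{\Delta}{1-\Delta},$$ then $g(\tilde X)=g(X)$ for every $\tilde X\in\mathcal B(X)$. -/

import Mathlib

open MeasureTheory ProbabilityTheory

namespace HierSmoothing

noncomputable section

/-- Data: real `N × D` matrices, given by their rows (the entities). -/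
abbrev Data (N D : ℕ) : Type := Fin N → Fin D → ℝ

/-- The extended space: a matrix together with the indicator column `τ ∈ {0,1}^N`
(`true` means that the row is selected for smoothing). -/
abbrev Ext (N D : ℕ) : Type := Data N D × (Fin N → Bool)

/-- The upper-level probability mass of `τ`: the entries are i.i.d. `Ber(p)`. -/
def selectProb {N : ℕ} (p : ℝ) (τ : Fin N → Bool) : ℝ :=
  ∏ i, if τ i then p else 1 - p

/-- The lower-level law of one row given its indicator: the isotropic Gaussian `𝒩(x, σ² I)` if the
row is selected, the Dirac measure at `x` otherwise. -/
def rowLaw {D : ℕ} (σ : ℝ) (x : Fin D → ℝ) (t : Bool) : Measure (Fin D → ℝ) :=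
  if t then Measure.pi (fun j => gaussianReal (x j) (σ ^ 2).toNNReal) else Measure.dirac x

/-- The hierarchical smoothing distribution `Ψ_X(W, τ) = μ_X(W | τ) φ(τ)` on the extended space. -/
def hierLaw {N D : ℕ} (p σ : ℝ) (X : Data N D) : Measure (Ext N D) :=
  ∑ τ : Fin N → Bool, ENNReal.ofReal (selectProb p τ) •
    (Measure.pi (fun i => rowLaw σ (X i) (τ i))).prod (Measure.dirac τ)

/-- `p_{X,y}`: the probability that the classifier `f` outputs `y` under `Ψ_X`. -/
def classProb {N D C : ℕ} (p σ : ℝ) (f : Ext N D → Fin C) (X : Data N D) (y : Fin C) : ℝ :=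
  (hierLaw p σ X).real {Z | f Z = y}

/-- `g(X) ∈ argmax_y p_{X,y}` for all `X`; ties may be broken in any way. -/
def IsSmoothedClassifier {N D C : ℕ} (p σ : ℝ) (f : Ext N D → Fin C)
    (g : Data N D → Fin C) : Prop :=
  ∀ X y, classProb p σ f X y ≤ classProb p σ f X (g X)

/-- The threat model: at most `r` rows are changed, and the Frobenius norm of the change is at
most `ε`. -/
def threatBall {N D : ℕ} (r : ℕ) (ε : ℝ) (X : Data N D) : Set (Data N D) :=
  {X' | hammingDist X X' ≤ r ∧ Real.sqrt (∑ i, ∑ j, (X i j - X' i j) ^ 2) ≤ ε}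

/-- The probabilities of label `y` at `X'`, over all (measurable) classifiers `h` whose probability
of label `y` at `X` equals `q`. -/
def feasibleProbs {N D C : ℕ} (p σ : ℝ) (X X' : Data N D) (y : Fin C) (q : ℝ) : Set ℝ :=
  {s | ∃ h : Ext N D → Fin C, Measurable h ∧ classProb p σ h X y = q ∧ classProb p σ h X' y = s}

/-- The upper bound `max_h Pr_{Ψ_{X'}}[h = y]` subject to `Pr_{Ψ_X}[h = y] = q`. -/
def upperProb {N D C : ℕ} (p σ : ℝ) (X X' : Data N D) (y : Fin C) (q : ℝ) : ℝ :=
  sSup (feasibleProbs p σ X X' y q)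

/-- The standard normal cumulative distribution function, with `Φ(-∞) = 0` and `Φ(+∞) = 1`. -/
def normalCDF (x : EReal) : ℝ :=
  if x = ⊥ then 0 else if x = ⊤ then 1 else cdf (gaussianReal 0 1) x.toReal

/-- The inverse standard normal cumulative distribution function: the ordinary inverse on `(0,1)`,
`-∞` for `t ≤ 0`, and `+∞` for `t ≥ 1`. -/
def normalQuantile (t : ℝ) : EReal :=
  sInf {x : EReal | t ≤ normalCDF x}

end

end HierSmoothing

namespace HierSmoothing

open Filter Topology

/-! Condition on `τ` and let `d` be the number of changed rows. If some changed row is unselected,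
it is revealed exactly, so the conditional laws at `X` and `X'` are mutually singular: the adversary
gains the whole mass `1 - p ^ d` of such `τ` at no cost under `X`. Otherwise the two laws differ by
a Gaussian shift of length `δ`, the Frobenius distance, and the likelihood ratio is a decreasing
function of one standard normal score that does not depend on `τ`. One half-space is therefore
Neyman–Pearson optimal for all these `τ` at once, and turns mass `t` into `Φ(Φ⁻¹(t) + δ/σ)`.

Hence an event of mass `q` at `X` has mass at most `p ^ d * Φ(Φ⁻¹(q / p ^ d) + δ/σ) + (1 - p ^ d)`
at `X'` (`hierLaw_real_le`), with equality possible when `q ≤ p ^ d` (`exists_hierLaw_eq`). The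
bound grows with `d` and `δ` (`mul_gaussShift_div_add_mono`), so the worst case is `d = r`, `δ = ε`,
which `exists_extremal_perturbation` realizes. The certificate uses the upper bound for the
competing label and, through complements, a lower bound for the predicted one. -/

/-! ### The standard normal distribution function and its quantile -/

theorem strictMono_cdf_gaussian : StrictMono (cdf (gaussianReal 0 1)) := by
  intro x y hxy
  have h : 0 < (gaussianReal 0 1).real (Set.Ioc x y) := by
    refine measureReal_nonneg.lt_of_ne' fun h0 => ?_
    rw [measureReal_eq_zero_iff] at h0
    have := gaussianReal_absolutelyContinuous' 0 one_ne_zero h0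
    rw [Real.volume_Ioc, ENNReal.ofReal_eq_zero] at this
    linarith
  rw [cdf_eq_real, cdf_eq_real, ← Set.Iic_union_Ioc_eq_Iic hxy.le,
    measureReal_union (Set.Iic_disjoint_Ioc le_rfl) measurableSet_Ioc]
  linarith

theorem continuous_cdf_gaussian : Continuous (cdf (gaussianReal 0 1)) := by
  rw [continuous_iff_continuousAt]
  intro x
  have : NullSingletonClass (gaussianReal 0 1) := nullSingletonClass_gaussianReal one_ne_zero
  have h := (cdf (gaussianReal 0 1)).measure_singleton x
  rw [measure_cdf, measure_singleton, eq_comm, ENNReal.ofReal_eq_zero] at h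
  rw [(monotone_cdf _).continuousAt_iff_leftLim_eq_rightLim, StieltjesFunction.rightLim_eq]
  exact le_antisymm ((monotone_cdf _).leftLim_le le_rfl) (by linarith)

theorem cdf_gaussian_pos (x : ℝ) : 0 < cdf (gaussianReal 0 1) x :=
  (cdf_nonneg _ (x - 1)).trans_lt (strictMono_cdf_gaussian (by linarith))

theorem cdf_gaussian_lt_one (x : ℝ) : cdf (gaussianReal 0 1) x < 1 :=
  (strictMono_cdf_gaussian (by linarith : x < x + 1)).trans_le (cdf_le_one _ _)

theorem exists_cdf_gaussian_eq {t : ℝ} (h0 : 0 < t) (h1 : t < 1) :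
    ∃ c, cdf (gaussianReal 0 1) c = t := by
  obtain ⟨a, ha⟩ := ((tendsto_cdf_atBot (gaussianReal 0 1)).eventually_lt_const h0).exists
  obtain ⟨b, hb⟩ := ((tendsto_cdf_atTop (gaussianReal 0 1)).eventually_const_lt h1).exists
  exact mem_range_of_exists_le_of_exists_ge continuous_cdf_gaussian ⟨a, ha.le⟩ ⟨b, hb.le⟩

theorem gaussianReal_real_Iic (m c : ℝ) :
    (gaussianReal m 1).real (Set.Iic c) = cdf (gaussianReal 0 1) (c - m) := by
  have h := gaussianReal_map_sub_const (μ := m) (v := 1) m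
  rw [sub_self] at h
  rw [cdf_eq_real, ← h, map_measureReal_apply (by fun_prop) measurableSet_Iic]
  congr 1
  ext x
  simp

theorem cdf_gaussian_neg (x : ℝ) :
    cdf (gaussianReal 0 1) (-x) = 1 - cdf (gaussianReal 0 1) x := by
  have : NullSingletonClass (gaussianReal 0 1) := nullSingletonClass_gaussianReal one_ne_zero
  have h := gaussianReal_map_neg (μ := 0) (v := 1)
  rw [neg_zero] at h
  rw [cdf_eq_real, cdf_eq_real, ← probReal_compl_eq_one_sub measurableSet_Iic]
  conv_lhs => rw [← h]
  rw [map_measureReal_apply (by fun_prop) measurableSet_Iic]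
  have : (fun x : ℝ => -x) ⁻¹' Set.Iic (-x) = Set.Ici x := by ext; simp
  rw [this, Set.compl_Iic]
  exact measureReal_congr Ioi_ae_eq_Ici.symm

@[simp] theorem normalCDF_bot : normalCDF ⊥ = 0 := by simp [normalCDF]

@[simp] theorem normalCDF_top : normalCDF ⊤ = 1 := by simp [normalCDF]

@[simp] theorem normalCDF_coe (x : ℝ) : normalCDF x = cdf (gaussianReal 0 1) x := by
  simp [normalCDF]

theorem normalCDF_le_one (x : EReal) : normalCDF x ≤ 1 := by
  induction x <;> simp [cdf_le_one]

theorem strictMono_normalCDF : StrictMono normalCDF := by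
  intro x y hxy
  induction x <;> induction y <;>
    simp_all [cdf_gaussian_pos, cdf_gaussian_lt_one, strictMono_cdf_gaussian.lt_iff_lt]

theorem normalQuantile_normalCDF (x : EReal) : normalQuantile (normalCDF x) = x := by
  simp only [normalQuantile, strictMono_normalCDF.le_iff_le]
  exact csInf_Ici

theorem monotone_normalQuantile : Monotone normalQuantile := fun _ _ h =>
  sInf_le_sInf fun _ hx => h.trans hx

theorem normalQuantile_of_nonpos {t : ℝ} (h : t ≤ 0) : normalQuantile t = ⊥ :=
  le_bot_iff.1 ((monotone_normalQuantile (h.trans_eq normalCDF_bot.symm)).trans_eq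
    (normalQuantile_normalCDF ⊥))

theorem normalQuantile_of_one_le {t : ℝ} (h : 1 ≤ t) : normalQuantile t = ⊤ :=
  top_le_iff.1 ((normalQuantile_normalCDF ⊤).symm.trans_le
    (monotone_normalQuantile (normalCDF_top.trans_le h)))

/-! ### The Gaussian shift function -/

noncomputable section

/-- The Gaussian shift `t ↦ Φ(Φ⁻¹(t) + a)`. -/
def gaussShift (t a : ℝ) : ℝ := normalCDF (normalQuantile t + (a : EReal))

end

theorem gaussShift_of_nonpos {t : ℝ} (h : t ≤ 0) (a : ℝ) : gaussShift t a = 0 := by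
  simp [gaussShift, normalQuantile_of_nonpos h]

theorem gaussShift_of_one_le {t : ℝ} (h : 1 ≤ t) (a : ℝ) : gaussShift t a = 1 := by
  simp [gaussShift, normalQuantile_of_one_le h]

theorem gaussShift_cdf (c a : ℝ) :
    gaussShift (cdf (gaussianReal 0 1) c) a = cdf (gaussianReal 0 1) (c + a) := by
  rw [gaussShift, ← normalCDF_coe, normalQuantile_normalCDF, ← EReal.coe_add, normalCDF_coe]

theorem gaussShift_mono {t t' a a' : ℝ} (ht : t ≤ t') (ha : a ≤ a') :
    gaussShift t a ≤ gaussShift t' a' :=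
  strictMono_normalCDF.monotone
    (add_le_add (monotone_normalQuantile ht) (EReal.coe_le_coe_iff.2 ha))

theorem gaussShift_le_one (t a : ℝ) : gaussShift t a ≤ 1 := normalCDF_le_one _

/-- The symmetry `Φ(-x) = 1 - Φ(x)`; it converts upper bounds on complements into lower bounds. -/
theorem gaussShift_neg (t a : ℝ) : gaussShift t (-a) = 1 - gaussShift (1 - t) a := by
  rcases le_or_gt t 0 with h0 | h0
  · rw [gaussShift_of_nonpos h0, gaussShift_of_one_le (by linarith), sub_self]
  rcases le_or_gt 1 t with h1 | h1
  · rw [gaussShift_of_one_le h1, gaussShift_of_nonpos (by linarith), sub_zero]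
  obtain ⟨c, rfl⟩ := exists_cdf_gaussian_eq h0 h1
  rw [gaussShift_cdf, ← cdf_gaussian_neg, gaussShift_cdf, ← cdf_gaussian_neg]
  ring_nf

/-- The optimal value decreases in the probability of selecting all the changed rows. -/
theorem mul_gaussShift_div_add_mono {q P P' a a' : ℝ} (hq : 0 ≤ q) (hP : 0 < P) (hPP : P ≤ P')
    (ha : a ≤ a') :
    P' * gaussShift (q / P') a + (1 - P') ≤ gaussShift (q / P) a' * P + (1 - P) := by
  have h : gaussShift (q / P') a ≤ gaussShift (q / P) a' :=
    gaussShift_mono (div_le_div_of_nonneg_left hq hP hPP) ha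
  -- With `G = gaussShift (q / P) a'`, what remains after `h` is `(P' - P) * (1 - G) ≥ 0`.
  nlinarith [gaussShift_le_one (q / P) a']

/-! ### Product measures, densities and the Neyman–Pearson lemma -/

/-- It suffices to compare on boxes, whose indicator is a product, so that the integral factors by
Fubini. -/
theorem pi_withDensity_ofReal {ι : Type*} [Fintype ι] {E : ι → Type*}
    [∀ i, MeasurableSpace (E i)] (μ : ∀ i, Measure (E i)) [∀ i, IsProbabilityMeasure (μ i)]
    (f : ∀ i, E i → ℝ) (hf0 : ∀ i x, 0 ≤ f i x) (hfi : ∀ i, Integrable (f i) (μ i)) :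
    Measure.pi (fun i => (μ i).withDensity fun x => ENNReal.ofReal (f i x)) =
      (Measure.pi μ).withDensity fun w => ENNReal.ofReal (∏ i, f i (w i)) := by
  have (i : ι) : IsFiniteMeasure ((μ i).withDensity fun x => ENNReal.ofReal (f i x)) :=
    isFiniteMeasure_withDensity_ofReal (hfi i).2
  refine Measure.pi_eq fun s hs => ?_
  have hF (i : ι) : Integrable ((s i).indicator (f i)) (μ i) := (hfi i).indicator (hs i)
  have hF0 (i : ι) (x : E i) : 0 ≤ (s i).indicator (f i) x :=
    Set.indicator_nonneg (fun x _ => hf0 i x) x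
  have hi (i : ι) : (μ i).withDensity (fun x => ENNReal.ofReal (f i x)) (s i) =
      ENNReal.ofReal (∫ x, (s i).indicator (f i) x ∂μ i) := by
    rw [withDensity_apply _ (hs i), ← lintegral_indicator (hs i),
      ofReal_integral_eq_lintegral_ofReal (hF i) (ae_of_all _ (hF0 i))]
    congr with x
    by_cases hx : x ∈ s i <;> simp [hx]
  simp_rw [hi]
  rw [← ENNReal.ofReal_prod_of_nonneg fun i _ => integral_nonneg (hF0 i),
    ← integral_fintype_prod_eq_prod, withDensity_apply _ (.univ_pi hs),
    ← lintegral_indicator (.univ_pi hs),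
    ofReal_integral_eq_lintegral_ofReal (Integrable.fintype_prod_dep hF)
      (ae_of_all _ fun w => Finset.prod_nonneg fun i _ => hF0 i _)]
  congr with w
  by_cases hw : w ∈ Set.univ.pi s
  · rw [Set.indicator_of_mem hw]
    congr 1
    exact Finset.prod_congr rfl fun i _ => (Set.indicator_of_mem (hw i (Set.mem_univ i)) _).symm
  · rw [Set.indicator_of_notMem hw]
    simp only [Set.mem_pi, Set.mem_univ, true_implies, not_forall] at hw
    obtain ⟨i, hi⟩ := hw
    rw [Finset.prod_eq_zero (Finset.mem_univ i) (Set.indicator_of_notMem hi _),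
      ENNReal.ofReal_zero]

/-- By independence the characteristic functions multiply. -/
theorem map_pi_sum_gaussianReal {ι : Type*} [Fintype ι] {E : ι → Type*}
    [∀ i, MeasurableSpace (E i)] (μ : ∀ i, Measure (E i)) [∀ i, IsProbabilityMeasure (μ i)]
    (f : ∀ i, E i → ℝ) (hf : ∀ i, Measurable (f i)) (m : ι → ℝ) (v : ι → NNReal)
    (h : ∀ i, (μ i).map (f i) = gaussianReal (m i) (v i)) :
    (Measure.pi μ).map (fun w => ∑ i, f i (w i)) = gaussianReal (∑ i, m i) (∑ i, v i) := by
  have hm : Measurable fun w : ∀ i, E i => ∑ i, f i (w i) := by fun_prop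
  have := Measure.isProbabilityMeasure_map (μ := Measure.pi μ) hm.aemeasurable
  refine Measure.ext_of_charFun ?_
  rw [iIndepFun.charFun_map_fun_sum_eq_prod (X := fun i (w : ∀ i, E i) => f i (w i))
    (fun i => ((hf i).comp (measurable_pi_apply i)).aemeasurable)
    (iIndepFun_pi fun i => (hf i).aemeasurable)]
  ext t
  have hi (i : ι) : (Measure.pi μ).map (fun w => f i (w i)) = gaussianReal (m i) (v i) := by
    rw [← h i, ← (measurePreserving_eval μ i).map_eq, Measure.map_map (hf i) (by fun_prop)]
    rfl
  simp_rw [Finset.prod_apply, hi, charFun_gaussianReal, ← Complex.exp_sum]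
  congr 1
  push_cast
  simp only [Finset.sum_sub_distrib, Finset.mul_sum, Finset.sum_mul, Finset.sum_div]

noncomputable section

/-- The likelihood ratio of `𝒩(x + d, s)` with respect to `𝒩(x, s)`. -/
def shiftRatio (s x d w : ℝ) : ℝ := Real.exp ((2 * (w - x) * d - d ^ 2) / (2 * s))

end

theorem measurable_shiftRatio (s x d : ℝ) : Measurable (shiftRatio s x d) := by
  unfold shiftRatio; fun_prop

/-- The degenerate alternative serves unselected, unchanged rows: there both laws are the same Dirac
mass and the ratio is 1, so all rows can be treated uniformly. -/
theorem gaussianReal_add_eq_withDensity {s : ℝ} {v : NNReal} (x d : ℝ)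
    (h : v ≠ 0 ∧ (v : ℝ) = s ∨ v = 0 ∧ d = 0) :
    gaussianReal (x + d) v =
      (gaussianReal x v).withDensity fun w => ENNReal.ofReal (shiftRatio s x d w) := by
  rcases h with ⟨hv, rfl⟩ | ⟨rfl, rfl⟩
  · rw [gaussianReal_of_var_ne_zero _ hv, gaussianReal_of_var_ne_zero _ hv,
      ← withDensity_mul _ (measurable_gaussianPDF _ _)
        (measurable_shiftRatio _ _ _).ennreal_ofReal]
    congr with w
    have hv' : (v : ℝ) ≠ 0 := by simpa using hv
    simp only [Pi.mul_apply, gaussianPDF, gaussianPDFReal, shiftRatio]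
    rw [← ENNReal.ofReal_mul (by positivity), mul_assoc _ (Real.exp _) (Real.exp _), ← Real.exp_add]
    congr 3
    field_simp
    ring
  · simp [shiftRatio]

theorem integrable_of_isFiniteMeasure_withDensity_ofReal {E : Type*} [MeasurableSpace E]
    {μ : Measure E} {f : E → ℝ} (hf : Measurable f) (hf0 : ∀ x, 0 ≤ f x)
    [IsFiniteMeasure (μ.withDensity fun x => ENNReal.ofReal (f x))] : Integrable f μ := by
  refine ⟨hf.aestronglyMeasurable, ?_⟩
  rw [hasFiniteIntegral_iff_ofReal (ae_of_all _ hf0), ← setLIntegral_univ,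
    ← withDensity_apply _ .univ]
  exact measure_lt_top _ _

/-- A product over a finite type of measures with densities, all of them probability measures. -/
theorem pi_eq_withDensity {ι : Type*} [Fintype ι] {E : ι → Type*}
    [∀ i, MeasurableSpace (E i)] (μ ν : ∀ i, Measure (E i)) [∀ i, IsProbabilityMeasure (μ i)]
    [∀ i, IsProbabilityMeasure (ν i)]
    (f : ∀ i, E i → ℝ) (hf0 : ∀ i x, 0 ≤ f i x) (hf : ∀ i, Measurable (f i))
    (h : ∀ i, ν i = (μ i).withDensity fun x => ENNReal.ofReal (f i x)) :
    Measure.pi ν = (Measure.pi μ).withDensity fun w => ENNReal.ofReal (∏ i, f i (w i)) := by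
  rw [← pi_withDensity_ofReal μ f hf0]
  · congr with i : 1
    exact h i
  · intro i
    have : IsFiniteMeasure ((μ i).withDensity fun x => ENNReal.ofReal (f i x)) := by
      rw [← h i]; infer_instance
    exact integrable_of_isFiniteMeasure_withDensity_ofReal (hf i) (hf0 i)

/-- Likelihood ratio sets are optimal (the Neyman–Pearson lemma in dual form). -/
theorem neyman_pearson {E : Type*} [MeasurableSpace E] {μ ν : Measure E} [IsFiniteMeasure μ]
    [IsFiniteMeasure ν] {f : E → ℝ} (hf : Measurable f) (hf0 : ∀ x, 0 ≤ f x)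
    (h : ν = μ.withDensity fun x => ENNReal.ofReal (f x)) (K : ℝ) {A : Set E}
    (hA : MeasurableSet A) :
    ν.real A ≤ K * μ.real A + (ν.real {x | K ≤ f x} - K * μ.real {x | K ≤ f x}) := by
  have hi : Integrable f μ := by
    subst h
    exact integrable_of_isFiniteMeasure_withDensity_ofReal hf hf0
  have hg : Integrable (fun x => f x - K) μ := hi.sub (integrable_const K)
  have key {B : Set E} (hB : MeasurableSet B) :
      ν.real B - K * μ.real B = ∫ x in B, (f x - K) ∂μ := by
    rw [integral_sub hi.integrableOn (integrableOn_const (by finiteness)), setIntegral_const,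
      smul_eq_mul, mul_comm, Measure.real, h, withDensity_apply _ hB,
      ← ofReal_integral_eq_lintegral_ofReal hi.integrableOn (ae_of_all _ hf0),
      ENNReal.toReal_ofReal (integral_nonneg hf0)]
  have hH : MeasurableSet {x | K ≤ f x} := measurableSet_le measurable_const hf
  have := key hA
  rw [key hH, ← sub_le_iff_le_add', this, ← integral_indicator hA, ← integral_indicator hH]
  -- Among all sets, `{K ≤ f}` maximizes the integral of `f - K`, already pointwise.
  refine integral_mono (hg.indicator hA) (hg.indicator hH) fun x => ?_
  by_cases h1 : x ∈ A <;> by_cases h2 : K ≤ f x <;> (simp [h1, h2]; try linarith)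

theorem pi_dirac {ι : Type*} [Fintype ι] {E : ι → Type*} [∀ i, MeasurableSpace (E i)]
    (x : ∀ i, E i) : Measure.pi (fun i => Measure.dirac (x i)) = Measure.dirac x := by
  refine Measure.pi_eq fun s hs => ?_
  simp_rw [Measure.dirac_apply' _ (.univ_pi hs), Measure.dirac_apply' _ (hs _)]
  by_cases hx : x ∈ Set.univ.pi s
  · rw [Set.indicator_of_mem hx, Finset.prod_eq_one fun i _ => ?_]
    · rfl
    · exact Set.indicator_of_mem (hx i (Set.mem_univ i)) _
  · rw [Set.indicator_of_notMem hx]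
    simp only [Set.mem_pi, Set.mem_univ, true_implies, not_forall] at hx
    obtain ⟨i, hi⟩ := hx
    exact (Finset.prod_eq_zero (Finset.mem_univ i) (Set.indicator_of_notMem hi _)).symm

/-! ### Conditional laws given the indicators -/

variable {N D : ℕ}

noncomputable section

/-- The variance of the entries of a row, given its indicator. -/
def rowVar (σ : ℝ) (t : Bool) : NNReal := if t then (σ ^ 2).toNNReal else 0

/-- The lower-level law of the whole matrix given the indicators. -/
def condLaw (σ : ℝ) (X : Data N D) (τ : Fin N → Bool) : Measure (Data N D) :=
  Measure.pi fun i => rowLaw σ (X i) (τ i)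

/-- All rows in which `X` and `X'` differ are selected. -/
def AllSelected (X X' : Data N D) (τ : Fin N → Bool) : Prop := ∀ i, X i ≠ X' i → τ i = true

/-- The Frobenius distance. -/
def frobDist (X X' : Data N D) : ℝ := Real.sqrt (∑ i, ∑ j, (X i j - X' i j) ^ 2)

/-- The standardized projection of `X - W` onto the direction `X' - X`. -/
def score (σ : ℝ) (X X' W : Data N D) : ℝ :=
  ∑ i, ∑ j, (X' i j - X i j) / (σ * frobDist X X') * (X i j - W i j)

end

theorem rowLaw_eq_pi (σ : ℝ) (x : Fin D → ℝ) (t : Bool) :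
    rowLaw σ x t = Measure.pi fun j => gaussianReal (x j) (rowVar σ t) := by
  cases t
  · simp [rowLaw, rowVar, pi_dirac]
  · simp [rowLaw, rowVar]

instance (σ : ℝ) (x : Fin D → ℝ) (t : Bool) : IsProbabilityMeasure (rowLaw σ x t) := by
  rw [rowLaw_eq_pi]; infer_instance

instance (σ : ℝ) (X : Data N D) (τ : Fin N → Bool) : IsProbabilityMeasure (condLaw σ X τ) := by
  unfold condLaw; infer_instance

theorem frobDist_sq (X X' : Data N D) : frobDist X X' ^ 2 = ∑ i, ∑ j, (X' i j - X i j) ^ 2 := by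
  rw [frobDist, Real.sq_sqrt (by positivity)]
  exact Finset.sum_congr rfl fun i _ => Finset.sum_congr rfl fun j _ => by ring

theorem frobDist_pos {X X' : Data N D} (h : X ≠ X') : 0 < frobDist X X' := by
  obtain ⟨i, hi⟩ := Function.ne_iff.1 h
  obtain ⟨j, hj⟩ := Function.ne_iff.1 hi
  refine Real.sqrt_pos.2 (Finset.sum_pos' (fun i _ => by positivity) ⟨i, Finset.mem_univ i, ?_⟩)
  refine Finset.sum_pos' (fun j _ => by positivity) ⟨j, Finset.mem_univ j, ?_⟩
  have := sub_ne_zero.2 hj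
  positivity

theorem measurable_score (σ : ℝ) (X X' : Data N D) : Measurable (score σ X X') := by
  unfold score; fun_prop

theorem gaussianReal_map_mul_sub (m b x : ℝ) (v : NNReal) :
    (gaussianReal m v).map (fun w => b * (x - w)) =
      gaussianReal (b * (x - m)) (NNReal.mk (b ^ 2) (sq_nonneg b) * v) := by
  rw [← gaussianReal_map_const_mul, ← gaussianReal_map_const_sub,
    Measure.map_map (by fun_prop) (by fun_prop)]
  rfl

theorem condLaw_map_score (σ : ℝ) (X X' Y : Data N D) (τ : Fin N → Bool) :
    (condLaw σ Y τ).map (score σ X X') =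
      gaussianReal (score σ X X' Y) (∑ i, ∑ j,
        NNReal.mk (((X' i j - X i j) / (σ * frobDist X X')) ^ 2) (sq_nonneg _) * rowVar σ (τ i)) := by
  refine map_pi_sum_gaussianReal _ (fun i (w : Fin D → ℝ) =>
    ∑ j, (X' i j - X i j) / (σ * frobDist X X') * (X i j - w j)) (fun i => by fun_prop) _ _
    fun i => ?_
  rw [rowLaw_eq_pi]
  exact map_pi_sum_gaussianReal _ (fun j (w : ℝ) =>
    (X' i j - X i j) / (σ * frobDist X X') * (X i j - w)) (fun j => by fun_prop) _ _
    fun j => gaussianReal_map_mul_sub _ _ _ _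

theorem coe_rowVar_true (σ : ℝ) : (rowVar σ true : ℝ) = σ ^ 2 := by
  simp [rowVar, sq_nonneg]

theorem rowVar_true_ne_zero {σ : ℝ} (hσ : 0 < σ) : rowVar σ true ≠ 0 := by
  rw [← NNReal.coe_ne_zero, coe_rowVar_true]
  positivity

variable {σ : ℝ} {X X' : Data N D} {τ : Fin N → Bool}

/-- Unchanged rows have coefficient zero in the score, so whether they are selected is irrelevant;
the changed ones contribute total variance 1. -/
theorem condLaw_map_score_of_allSelected (hσ : 0 < σ) (hX : X ≠ X') (hτ : AllSelected X X' τ)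
    (Y : Data N D) :
    (condLaw σ Y τ).map (score σ X X') = gaussianReal (score σ X X' Y) 1 := by
  rw [condLaw_map_score]
  congr 1
  have hδ := frobDist_pos hX
  rw [← NNReal.coe_inj]
  push_cast
  have (i : Fin N) (j : Fin D) : ((X' i j - X i j) / (σ * frobDist X X')) ^ 2 * rowVar σ (τ i) =
      (X' i j - X i j) ^ 2 * (1 / frobDist X X' ^ 2) := by
    by_cases h : X i = X' i
    · simp [h]
    · rw [hτ i h, coe_rowVar_true]
      field_simp
  refine (Finset.sum_congr rfl fun i _ => Finset.sum_congr rfl fun j _ => this i j).trans ?_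
  simp_rw [← Finset.sum_mul]
  rw [← frobDist_sq]
  field_simp

theorem score_self (σ : ℝ) (X X' : Data N D) : score σ X X' X = 0 := by simp [score]

theorem score_right (hσ : 0 < σ) (hX : X ≠ X') :
    score σ X X' X' = -(frobDist X X' / σ) := by
  have hδ := frobDist_pos hX
  have (i : Fin N) (j : Fin D) : (X' i j - X i j) / (σ * frobDist X X') * (X i j - X' i j) =
      (X' i j - X i j) ^ 2 * (-1 / (σ * frobDist X X')) := by
    field_simp
    ring
  simp_rw [score, this, ← Finset.sum_mul]
  rw [← frobDist_sq]
  field_simp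

/-- The likelihood ratio depends on `W` only through the score and decreases in it, so likelihood
ratio sets are half-spaces. -/
theorem prod_shiftRatio (hσ : 0 < σ) (hX : X ≠ X') (W : Data N D) :
    ∏ i, ∏ j, shiftRatio (σ ^ 2) (X i j) (X' i j - X i j) (W i j) =
      Real.exp (-(frobDist X X' / σ) * score σ X X' W - (frobDist X X' / σ) ^ 2 / 2) := by
  have hδ := frobDist_pos hX
  simp_rw [shiftRatio, ← Real.exp_sum]
  congr 1
  rw [div_pow, frobDist_sq, score]
  simp_rw [Finset.sum_div, Finset.mul_sum, ← Finset.sum_sub_distrib]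
  refine Finset.sum_congr rfl fun i _ => Finset.sum_congr rfl fun j _ => ?_
  field_simp
  ring

theorem condLaw_eq_withDensity (hσ : 0 < σ) (hX : X ≠ X') (hτ : AllSelected X X' τ) :
    condLaw σ X' τ = (condLaw σ X τ).withDensity fun W => ENNReal.ofReal
      (Real.exp (-(frobDist X X' / σ) * score σ X X' W - (frobDist X X' / σ) ^ 2 / 2)) := by
  simp_rw [← prod_shiftRatio hσ hX]
  have h0 (i j w) : 0 ≤ shiftRatio (σ ^ 2) (X i j) (X' i j - X i j) w := (Real.exp_pos _).le
  refine pi_eq_withDensity _ _ (fun i (w : Fin D → ℝ) =>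
    ∏ j, shiftRatio (σ ^ 2) (X i j) (X' i j - X i j) (w j))
    (fun i w => Finset.prod_nonneg fun j _ => h0 _ _ _)
    (fun i => Finset.measurable_prod _ fun j _ =>
      (measurable_shiftRatio _ _ _).comp (measurable_pi_apply j)) fun i => ?_
  rw [rowLaw_eq_pi, rowLaw_eq_pi]
  refine pi_eq_withDensity _ _ (fun j w => shiftRatio (σ ^ 2) (X i j) (X' i j - X i j) w)
    (fun j w => h0 _ _ _) (fun j => measurable_shiftRatio _ _ _) fun j => ?_
  rw [← gaussianReal_add_eq_withDensity, add_sub_cancel]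
  by_cases h : X i = X' i
  · cases ht : τ i
    · right; simp [rowVar, h]
    · exact .inl ⟨rowVar_true_ne_zero hσ, coe_rowVar_true σ⟩
  · rw [hτ i h]
    exact .inl ⟨rowVar_true_ne_zero hσ, coe_rowVar_true σ⟩

theorem condLaw_real_score_le (hσ : 0 < σ) (hX : X ≠ X') (hτ : AllSelected X X' τ) (c : ℝ) :
    (condLaw σ X τ).real {W | score σ X X' W ≤ c} = cdf (gaussianReal 0 1) c ∧
    (condLaw σ X' τ).real {W | score σ X X' W ≤ c} =
      cdf (gaussianReal 0 1) (c + frobDist X X' / σ) := by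
  have h (Y : Data N D) : (condLaw σ Y τ).real {W | score σ X X' W ≤ c} =
      cdf (gaussianReal 0 1) (c - score σ X X' Y) := by
    rw [← gaussianReal_real_Iic, ← condLaw_map_score_of_allSelected hσ hX hτ,
      map_measureReal_apply (measurable_score _ _ _) measurableSet_Iic]
    rfl
  rw [h, h, score_self, score_right hσ hX]
  simp

/-- The optimal trade-off between the two conditional laws, at a fixed level. -/
theorem exists_condLaw_tradeoff (hσ : 0 < σ) (hX : X ≠ X') {t : ℝ} (ht0 : 0 < t) (ht1 : t < 1) :
    ∃ K M : ℝ, 0 ≤ K ∧ K * t + M = gaussShift t (frobDist X X' / σ) ∧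
      ∀ τ, AllSelected X X' τ → ∀ A, MeasurableSet A →
        (condLaw σ X' τ).real A ≤ K * (condLaw σ X τ).real A + M := by
  obtain ⟨c, rfl⟩ := exists_cdf_gaussian_eq ht0 ht1
  set a := frobDist X X' / σ with ha
  have ha0 : 0 < a := div_pos (frobDist_pos hX) hσ
  -- `K` is the likelihood ratio at score `c`, and `M` makes the affine bound tight at `t = Φ(c)`.
  -- Neither depends on `τ`.
  refine ⟨Real.exp (-a * c - a ^ 2 / 2), cdf (gaussianReal 0 1) (c + a) -
    Real.exp (-a * c - a ^ 2 / 2) * cdf (gaussianReal 0 1) c, (Real.exp_pos _).le, ?_,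
    fun τ hτ A hA => ?_⟩
  · rw [gaussShift_cdf]; ring
  have := neyman_pearson (((measurable_score σ X X').const_mul (-a)).sub_const (a ^ 2 / 2)).exp
    (fun _ => (Real.exp_pos _).le) (condLaw_eq_withDensity hσ hX hτ)
    (Real.exp (-a * c - a ^ 2 / 2)) hA
  have hH : {W | Real.exp (-a * c - a ^ 2 / 2) ≤
      Real.exp (-a * score σ X X' W - a ^ 2 / 2)} = {W | score σ X X' W ≤ c} := by
    ext W
    simp [ha0]
  obtain ⟨h1, h2⟩ := condLaw_real_score_le hσ hX hτ c
  rwa [hH, h1, h2] at this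

/-! ### The mixture over the indicators: upper bound -/

variable {C : ℕ} {p : ℝ}

theorem selectProb_nonneg (hp0 : 0 < p) (hp1 : p ≤ 1) (τ : Fin N → Bool) :
    0 ≤ selectProb p τ := by
  refine Finset.prod_nonneg fun i _ => ?_
  split_ifs <;> linarith

theorem hierLaw_real_apply (hp0 : 0 < p) (hp1 : p ≤ 1) (σ : ℝ) (X : Data N D)
    {A : Set (Ext N D)} (hA : MeasurableSet A) :
    (hierLaw p σ X).real A =
      ∑ τ, selectProb p τ * (condLaw σ X τ).real {W | (W, τ) ∈ A} := by
  rw [Measure.real, hierLaw, Measure.finsetSum_apply, ENNReal.toReal_sum]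
  · refine Finset.sum_congr rfl fun τ _ => ?_
    rw [Measure.smul_apply, smul_eq_mul, ENNReal.toReal_mul,
      ENNReal.toReal_ofReal (selectProb_nonneg hp0 hp1 τ), Measure.prod_dirac,
      Measure.map_apply (by fun_prop) hA]
    rfl
  · intro τ _
    rw [Measure.smul_apply, smul_eq_mul]
    finiteness

open Classical in
theorem sum_selectProb_allSelected (p : ℝ) (X X' : Data N D) :
    ∑ τ with AllSelected X X' τ, selectProb p τ = p ^ hammingDist X X' := by
  rw [Finset.sum_filter]
  have (τ : Fin N → Bool) : (if AllSelected X X' τ then selectProb p τ else 0) =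
      ∏ i, if X i ≠ X' i ∧ τ i = false then 0 else if τ i then p else 1 - p := by
    by_cases h : AllSelected X X' τ
    · rw [if_pos h]
      refine Finset.prod_congr rfl fun i _ => ?_
      exact (if_neg fun ⟨h1, h2⟩ => by simp [h i h1] at h2).symm
    · rw [if_neg h]
      simp only [AllSelected, not_forall] at h
      obtain ⟨i, h1, h2⟩ := h
      rw [Finset.prod_eq_zero (Finset.mem_univ i)]
      simp_all
  simp_rw [this]
  -- Exchanging sum and product, a changed row contributes `p` and an unchanged one `p + (1 - p) =
  -- 1`.
  have h := Finset.prod_univ_sum (fun _ : Fin N => (Finset.univ : Finset Bool))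
    (fun i b => if X i ≠ X' i ∧ b = false then 0 else if b then p else 1 - p)
  rw [Fintype.piFinset_univ] at h
  rw [← h, hammingDist]
  simp only [Fintype.sum_bool]
  rw [← Finset.prod_const, Finset.prod_filter]
  refine Finset.prod_congr rfl fun i _ => ?_
  by_cases hi : X i = X' i <;> simp [hi]

theorem sum_selectProb (p : ℝ) : ∑ τ : Fin N → Bool, selectProb p τ = 1 := by
  classical
  -- For equal matrices every `τ` qualifies and the exponent is 0.
  simpa [AllSelected] using sum_selectProb_allSelected p (0 : Data N 0) 0

open Classical in
theorem sum_selectProb_not_allSelected (p : ℝ) (X X' : Data N D) :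
    ∑ τ with ¬ AllSelected X X' τ, selectProb p τ = 1 - p ^ hammingDist X X' := by
  rw [← sum_selectProb_allSelected, eq_sub_iff_add_eq', Finset.sum_filter_add_sum_filter_not,
    sum_selectProb]

theorem isProbabilityMeasure_hierLaw (hp0 : 0 < p) (hp1 : p ≤ 1) (σ : ℝ) (X : Data N D) :
    IsProbabilityMeasure (hierLaw p σ X) := by
  have := hierLaw_real_apply hp0 hp1 σ X .univ
  simp only [Set.mem_univ, Set.ofPred_true, probReal_univ, mul_one, sum_selectProb] at this
  exact ⟨(ENNReal.toReal_eq_one_iff _).1 this⟩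

theorem gaussShift_zero {t : ℝ} (h0 : 0 ≤ t) (h1 : t ≤ 1) : gaussShift t 0 = t := by
  rcases h0.eq_or_lt with rfl | h0
  · exact gaussShift_of_nonpos le_rfl 0
  rcases h1.eq_or_lt with rfl | h1
  · exact gaussShift_of_one_le le_rfl 0
  obtain ⟨c, rfl⟩ := exists_cdf_gaussian_eq h0 h1
  rw [gaussShift_cdf, add_zero]

/-- The conditional trade-off is affine with constants common to all good `τ`, so it survives
averaging; the other `τ` contribute at most their total probability. Only `≤ t` is required, which
leaves room for a limit `t → 0`. -/
theorem hierLaw_real_le_of_le (hp0 : 0 < p) (hp1 : p ≤ 1) (hσ : 0 < σ) (hX : X ≠ X')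
    {A : Set (Ext N D)} (hA : MeasurableSet A) {t : ℝ} (ht0 : 0 < t) (ht1 : t < 1)
    (ht : (hierLaw p σ X).real A / p ^ hammingDist X X' ≤ t) :
    (hierLaw p σ X').real A ≤ p ^ hammingDist X X' * gaussShift t (frobDist X X' / σ) +
      (1 - p ^ hammingDist X X') := by
  classical
  obtain ⟨K, M, hK, hKM, h⟩ := exists_condLaw_tradeoff hσ hX ht0 ht1
  have hs := selectProb_nonneg (N := N) hp0 hp1
  have hP : 0 < p ^ hammingDist X X' := by positivity
  have hfib (τ : Fin N → Bool) : MeasurableSet {W | (W, τ) ∈ A} := measurable_prodMk_right hA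
  have h1 : ∑ τ with AllSelected X X' τ, selectProb p τ * (condLaw σ X τ).real {W | (W, τ) ∈ A} ≤
      (hierLaw p σ X).real A := by
    rw [hierLaw_real_apply hp0 hp1 σ X hA]
    exact Finset.sum_le_univ_sum_of_nonneg fun τ => mul_nonneg (hs τ) measureReal_nonneg
  have h2 : ∑ τ with AllSelected X X' τ,
      selectProb p τ * (condLaw σ X' τ).real {W | (W, τ) ∈ A} ≤
      K * (hierLaw p σ X).real A + p ^ hammingDist X X' * M := by
    calc
      _ ≤ ∑ τ with AllSelected X X' τ, (K * (selectProb p τ *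
            (condLaw σ X τ).real {W | (W, τ) ∈ A}) + selectProb p τ * M) := by
        refine Finset.sum_le_sum fun τ hτ => ?_
        have := mul_le_mul_of_nonneg_left (h τ (Finset.mem_filter.1 hτ).2 _ (hfib τ)) (hs τ)
        linarith
      _ ≤ _ := by
        rw [Finset.sum_add_distrib, ← Finset.mul_sum, ← Finset.sum_mul,
          sum_selectProb_allSelected]
        gcongr
  have h3 : ∑ τ with ¬ AllSelected X X' τ,
      selectProb p τ * (condLaw σ X' τ).real {W | (W, τ) ∈ A} ≤ 1 - p ^ hammingDist X X' := by
    rw [← sum_selectProb_not_allSelected]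
    exact Finset.sum_le_sum fun τ _ => mul_le_of_le_one_right (hs τ) measureReal_le_one
  rw [hierLaw_real_apply hp0 hp1 σ X' hA,
    ← Finset.sum_filter_add_sum_filter_not _ (AllSelected X X'), ← hKM]
  rw [div_le_iff₀ hP] at ht
  have := mul_le_mul_of_nonneg_left ht hK
  linarith

/-- The upper bound on the probability of an event under the law at `X'`. -/
theorem hierLaw_real_le (hp0 : 0 < p) (hp1 : p ≤ 1) (hσ : 0 < σ) (X X' : Data N D)
    {A : Set (Ext N D)} (hA : MeasurableSet A) :
    (hierLaw p σ X').real A ≤ p ^ hammingDist X X' *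
      gaussShift ((hierLaw p σ X).real A / p ^ hammingDist X X') (frobDist X X' / σ) +
      (1 - p ^ hammingDist X X') := by
  have := isProbabilityMeasure_hierLaw hp0 hp1 σ X
  have := isProbabilityMeasure_hierLaw hp0 hp1 σ X'
  -- The score divides by the Frobenius distance, so equal matrices are handled apart.
  rcases eq_or_ne X X' with rfl | hX
  · simp [frobDist, gaussShift_zero measureReal_nonneg measureReal_le_one]
  set t := (hierLaw p σ X).real A / p ^ hammingDist X X' with ht
  have ht0 : 0 ≤ t := by positivity
  rcases le_or_gt 1 t with h1 | h1
  · rw [gaussShift_of_one_le h1]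
    linarith [measureReal_le_one (μ := hierLaw p σ X') (s := A)]
  rcases ht0.eq_or_lt with h0 | h0
  · rw [gaussShift_of_nonpos h0.ge]
    -- Mass zero corresponds to no real threshold: use the bound at level `Φ(c)` and let `c → -∞`.
    have hc : Filter.Tendsto (fun c : ℝ => c + frobDist X X' / σ) .atBot .atBot :=
      Filter.tendsto_atBot_add_const_right _ _ Filter.tendsto_id
    refine ge_of_tendsto ((((tendsto_cdf_atBot (gaussianReal 0 1)).comp hc).const_mul
      (p ^ hammingDist X X')).add_const (1 - p ^ hammingDist X X')) (.of_forall fun c => ?_)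
    rw [Function.comp_apply, ← gaussShift_cdf]
    exact hierLaw_real_le_of_le hp0 hp1 hσ hX hA (cdf_gaussian_pos c) (cdf_gaussian_lt_one c)
      ((ht.symm.trans h0.symm).trans_le (cdf_nonneg _ _))
  · exact hierLaw_real_le_of_le hp0 hp1 hσ hX hA h0 h1 ht.ge

/-! ### Sharpness: optimal events -/

theorem exists_condLaw_eq (hσ : 0 < σ) (hX : X ≠ X') {t : ℝ} (ht0 : 0 ≤ t) (ht1 : t ≤ 1) :
    ∃ B : Set (Data N D), MeasurableSet B ∧ ∀ τ, AllSelected X X' τ →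
      (condLaw σ X τ).real B = t ∧
      (condLaw σ X' τ).real B = gaussShift t (frobDist X X' / σ) := by
  rcases ht0.eq_or_lt with rfl | ht0
  · exact ⟨∅, .empty, fun τ _ => by simp [gaussShift_of_nonpos]⟩
  rcases ht1.eq_or_lt with rfl | ht1
  · exact ⟨.univ, .univ, fun τ _ => by simp [gaussShift_of_one_le]⟩
  obtain ⟨c, rfl⟩ := exists_cdf_gaussian_eq ht0 ht1
  refine ⟨{W | score σ X X' W ≤ c}, measurableSet_le (measurable_score _ _ _) measurable_const,
    fun τ hτ => ?_⟩
  rw [gaussShift_cdf]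
  exact condLaw_real_score_le hσ hX hτ c

/-- If a changed row is not selected, the conditional laws at `X` and `X'` are separated by the
event that the unselected rows are those of `X'`. -/
theorem condLaw_real_unselected (X X' : Data N D) {τ : Fin N → Bool}
    (hτ : ¬ AllSelected X X' τ) :
    (condLaw σ X τ).real {W | ∀ i, τ i = false → W i = X' i} = 0 ∧
    (condLaw σ X' τ).real {W | ∀ i, τ i = false → W i = X' i} = 1 := by
  have hset : {W : Data N D | ∀ i, τ i = false → W i = X' i} =
      Set.univ.pi fun i => if τ i then Set.univ else {X' i} := by
    ext W
    simp only [Set.mem_ofPred_eq, Set.mem_pi, Set.mem_univ, true_implies]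
    refine forall_congr' fun i => ?_
    cases τ i <;> simp
  rw [hset, Measure.real, Measure.real, condLaw, condLaw, Measure.pi_pi, Measure.pi_pi]
  constructor
  · simp only [AllSelected, not_forall] at hτ
    obtain ⟨i, h1, h2⟩ := hτ
    rw [Finset.prod_eq_zero (Finset.mem_univ i), ENNReal.toReal_zero]
    simp_all [rowLaw]
  · rw [Finset.prod_eq_one, ENNReal.toReal_one]
    intro i _
    cases h : τ i <;> simp [rowLaw]

/-- Glue fibrewise: the common optimal set `B` where all changed rows are selected, and elsewhere
the separating event, which is null at `X` and has full mass at `X'`. -/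
theorem exists_hierLaw_eq (hp0 : 0 < p) (hp1 : p ≤ 1) (hσ : 0 < σ) (hX : X ≠ X') {t : ℝ}
    (ht0 : 0 ≤ t) (ht1 : t ≤ 1) :
    ∃ A : Set (Ext N D), MeasurableSet A ∧
      (hierLaw p σ X).real A = p ^ hammingDist X X' * t ∧
      (hierLaw p σ X').real A = p ^ hammingDist X X' * gaussShift t (frobDist X X' / σ) +
        (1 - p ^ hammingDist X X') := by
  classical
  obtain ⟨B, hB, h⟩ := exists_condLaw_eq hσ hX ht0 ht1
  set F : (Fin N → Bool) → Set (Data N D) := fun τ =>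
    if AllSelected X X' τ then B else {W | ∀ i, τ i = false → W i = X' i} with hF
  have hFm (τ : Fin N → Bool) : MeasurableSet (F τ) := by
    simp only [hF]
    split_ifs
    · exact hB
    · simp only [Set.ofPred_forall]
      exact .iInter fun i => .iInter fun _ =>
        measurableSet_eq_fun (measurable_pi_apply i) measurable_const
  have hA : MeasurableSet (⋃ τ, F τ ×ˢ {τ}) :=
    .iUnion fun τ => (hFm τ).prod (measurableSet_singleton τ)
  have hfib (τ : Fin N → Bool) : {W | (W, τ) ∈ ⋃ τ, F τ ×ˢ {τ}} = F τ := by ext; simp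
  refine ⟨_, hA, ?_, ?_⟩
  · rw [hierLaw_real_apply hp0 hp1 σ X hA,
      ← Finset.sum_filter_add_sum_filter_not _ (AllSelected X X')]
    simp_rw [hfib]
    rw [← sum_selectProb_allSelected, Finset.sum_mul]
    refine (congrArg₂ (· + ·) (Finset.sum_congr rfl fun τ hτ => ?_)
      (Finset.sum_eq_zero fun τ hτ => ?_)).trans (add_zero _)
    · have hτ := (Finset.mem_filter.1 hτ).2
      simp only [hF, if_pos hτ, (h τ hτ).1]
    · have hτ := (Finset.mem_filter.1 hτ).2
      simp only [hF, if_neg hτ, (condLaw_real_unselected X X' hτ).1, mul_zero]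
  · rw [hierLaw_real_apply hp0 hp1 σ X' hA,
      ← Finset.sum_filter_add_sum_filter_not _ (AllSelected X X')]
    simp_rw [hfib]
    rw [← sum_selectProb_not_allSelected, ← sum_selectProb_allSelected, Finset.sum_mul]
    congr 1
    · refine Finset.sum_congr rfl fun τ hτ => ?_
      have hτ := (Finset.mem_filter.1 hτ).2
      simp only [hF, if_pos hτ, (h τ hτ).2]
    · refine Finset.sum_congr rfl fun τ hτ => ?_
      have hτ := (Finset.mem_filter.1 hτ).2
      simp only [hF, if_neg hτ, (condLaw_real_unselected X X' hτ).2, mul_one]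

/-! ### Bounds over the threat model and attainment by classifiers -/

variable {ε : ℝ} {r : ℕ}

theorem hierLaw_real_le_of_mem (hp0 : 0 < p) (hp1 : p ≤ 1) (hσ : 0 < σ)
    (hX' : X' ∈ threatBall r ε X) {A : Set (Ext N D)} (hA : MeasurableSet A) :
    (hierLaw p σ X').real A ≤
      gaussShift ((hierLaw p σ X).real A / p ^ r) (ε / σ) * p ^ r + (1 - p ^ r) :=
  (hierLaw_real_le hp0 hp1 hσ X X' hA).trans (mul_gaussShift_div_add_mono measureReal_nonneg
    (by positivity) (pow_le_pow_of_le_one hp0.le hp1 hX'.1)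
    (div_le_div_of_nonneg_right hX'.2 hσ.le))

theorem le_hierLaw_real_of_mem (hp0 : 0 < p) (hp1 : p ≤ 1) (hσ : 0 < σ)
    (hX' : X' ∈ threatBall r ε X) {A : Set (Ext N D)} (hA : MeasurableSet A) :
    gaussShift (((hierLaw p σ X).real A - (1 - p ^ r)) / p ^ r) (-(ε / σ)) * p ^ r ≤
      (hierLaw p σ X').real A := by
  have := isProbabilityMeasure_hierLaw hp0 hp1 σ X
  have := isProbabilityMeasure_hierLaw hp0 hp1 σ X'
  have h := hierLaw_real_le_of_mem hp0 hp1 hσ hX' hA.compl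
  rw [probReal_compl_eq_one_sub hA, probReal_compl_eq_one_sub hA] at h
  rw [gaussShift_neg]
  have hP : p ^ r ≠ 0 := by positivity
  have : 1 - ((hierLaw p σ X).real A - (1 - p ^ r)) / p ^ r =
      (1 - (hierLaw p σ X).real A) / p ^ r := by
    field_simp
    ring
  rw [this]
  linarith

theorem mem_feasibleProbs (hp0 : 0 < p) (hp1 : p ≤ 1) (hσ : 0 < σ) (hX : X ≠ X')
    {f : Ext N D → Fin C} (hf : Measurable f) {y : Fin C}
    (hq : classProb p σ f X y ≤ p ^ hammingDist X X') :
    p ^ hammingDist X X' *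
        gaussShift (classProb p σ f X y / p ^ hammingDist X X') (frobDist X X' / σ) +
      (1 - p ^ hammingDist X X') ∈ feasibleProbs p σ X X' y (classProb p σ f X y) := by
  classical
  have := isProbabilityMeasure_hierLaw hp0 hp1 σ X
  have := isProbabilityMeasure_hierLaw hp0 hp1 σ X'
  have hP : 0 < p ^ hammingDist X X' := by positivity
  rcases subsingleton_or_nontrivial (Fin C) with hC | hC
  -- With a single label no event can be encoded, but then the label has probability 1, `hq` forces
  -- `p ^ d = 1`, and the value is 1.
  · have h1 (Y : Data N D) : {Z | f Z = y} = .univ :=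
      Set.eq_univ_of_forall fun Z => Subsingleton.elim _ _
    have hP1 : p ^ hammingDist X X' = 1 :=
      le_antisymm (pow_le_one₀ hp0.le hp1) (by simpa [classProb, h1 X] using hq)
    refine ⟨f, hf, rfl, ?_⟩
    simp [classProb, h1 X, hP1, gaussShift_of_one_le]
  · obtain ⟨y', hy'⟩ := exists_ne y
    obtain ⟨A, hA, h1, h2⟩ := exists_hierLaw_eq hp0 hp1 hσ hX
      (t := classProb p σ f X y / p ^ hammingDist X X')
      (div_nonneg measureReal_nonneg hP.le) ((div_le_one hP).2 hq)
    have hset : {Z | (if Z ∈ A then y else y') = y} = A := by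
      ext Z
      by_cases hZ : Z ∈ A <;> simp [hZ, hy']
    refine ⟨fun Z => if Z ∈ A then y else y', .ite hA measurable_const measurable_const, ?_, ?_⟩
    · rw [classProb, hset, h1]
      field_simp
    · rw [classProb, hset, h2]

/-- The optimal value of the constrained maximization at a fixed perturbed matrix. -/
theorem isGreatest_feasibleProbs (hp0 : 0 < p) (hp1 : p ≤ 1) (hσ : 0 < σ) (X X' : Data N D)
    {f : Ext N D → Fin C} (hf : Measurable f) {y : Fin C}
    (hq : classProb p σ f X y ≤ p ^ hammingDist X X') :
    IsGreatest (feasibleProbs p σ X X' y (classProb p σ f X y))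
      (p ^ hammingDist X X' *
        gaussShift (classProb p σ f X y / p ^ hammingDist X X') (frobDist X X' / σ) +
      (1 - p ^ hammingDist X X')) := by
  have := isProbabilityMeasure_hierLaw hp0 hp1 σ X
  constructor
  · rcases eq_or_ne X X' with rfl | hX
    · refine ⟨f, hf, rfl, ?_⟩
      simp [frobDist, classProb, gaussShift_zero measureReal_nonneg measureReal_le_one]
    · exact mem_feasibleProbs hp0 hp1 hσ hX hf hq
  · rintro s ⟨h, hh, h1, rfl⟩
    rw [← h1]
    exact hierLaw_real_le hp0 hp1 hσ X X' (measurableSet_eq_fun hh measurable_const)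

theorem exists_extremal_perturbation (X : Data N D) (hε : 0 < ε) (hr : 1 ≤ r) (hrN : r ≤ N)
    (hD : 1 ≤ D) : ∃ X' : Data N D, hammingDist X X' = r ∧ frobDist X X' = ε := by
  have hr0 : (0 : ℝ) < r := by exact_mod_cast hr
  have hcard : (Finset.univ.filter fun i : Fin N => i.val < r).card = r := by
    rw [Fin.card_filter_val_lt, min_eq_right hrN]
  have hd : 0 < ε / Real.sqrt r := by positivity
  -- Spread the budget evenly: the first `r` rows each move by `ε / √r` in one coordinate.
  refine ⟨fun i j => if i.val < r ∧ j.val = 0 then X i j + ε / Real.sqrt r else X i j, ?_, ?_⟩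
  · rw [hammingDist]
    refine Eq.trans (congrArg _ (Finset.filter_congr fun i _ => ?_)) hcard
    by_cases hi : i.val < r
    · simp only [hi, true_and, iff_true]
      intro h
      have := congrFun h ⟨0, hD⟩
      simp [hr0.ne', hε.ne'] at this
    · simp [hi]
  · have (i : Fin N) : ∑ j : Fin D, (X i j -
        (if i.val < r ∧ j.val = 0 then X i j + ε / Real.sqrt r else X i j)) ^ 2 =
        if i.val < r then ε ^ 2 / r else 0 := by
      rw [Finset.sum_eq_single ⟨0, hD⟩]
      · split_ifs <;> simp_all [div_pow]
      · intro j _ hj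
        have : j.val ≠ 0 := fun h => hj (Fin.ext h)
        simp [this]
      · simp
    simp_rw [frobDist, this]
    rw [← Finset.sum_filter, Finset.sum_const, hcard, nsmul_eq_mul, mul_div_cancel₀ _ hr0.ne',
      Real.sqrt_sq hε.le]

end HierSmoothing

theorem mainTheorem9 {N D C : ℕ} (p σ ε : ℝ) (r : ℕ)
    (hp0 : 0 < p) (hp1 : p ≤ 1) (hσ : 0 < σ) (hε : 0 ≤ ε)
    (Δ : ℝ) (hΔ : Δ = 1 - p ^ r)
    (f : HierSmoothing.Ext N D → Fin C) (hf : Measurable f) (X : HierSmoothing.Data N D) :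
    -- the maximum of the upper bound over the threat model
    (0 < ε → 1 ≤ r → r ≤ N → 1 ≤ D →
      ∀ y : Fin C, HierSmoothing.classProb p σ f X y ≤ 1 - Δ →
        (∀ X' ∈ HierSmoothing.threatBall r ε X,
          IsGreatest
            (HierSmoothing.feasibleProbs p σ X X' y (HierSmoothing.classProb p σ f X y))
            (HierSmoothing.upperProb p σ X X' y (HierSmoothing.classProb p σ f X y))) ∧
        IsGreatest
          ((fun X' => HierSmoothing.upperProb p σ X X' y (HierSmoothing.classProb p σ f X y)) ''
            HierSmoothing.threatBall r ε X)
          (HierSmoothing.normalCDF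
              (HierSmoothing.normalQuantile (HierSmoothing.classProb p σ f X y / (1 - Δ))
                + ((ε / σ : ℝ) : EReal)) * (1 - Δ) + Δ)) ∧
    -- the multi-class certificate
    (∀ g : HierSmoothing.Data N D → Fin C, HierSmoothing.IsSmoothedClassifier p σ f g →
      (∀ y : Fin C, y ≠ g X →
        HierSmoothing.normalCDF
            (HierSmoothing.normalQuantile (HierSmoothing.classProb p σ f X y / (1 - Δ))
              + ((ε / σ : ℝ) : EReal)) + Δ / (1 - Δ)
          < HierSmoothing.normalCDF
              (HierSmoothing.normalQuantile
                  ((HierSmoothing.classProb p σ f X (g X) - Δ) / (1 - Δ))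
                - ((ε / σ : ℝ) : EReal))) →
      ∀ X' ∈ HierSmoothing.threatBall r ε X, g X' = g X) := by
  subst hΔ
  simp only [sub_sub_cancel]
  have hP : 0 < p ^ r := by positivity
  refine ⟨fun hε' hr hrN hD y hq => ?_, fun g hg h X' hX' => ?_⟩
  -- Since `p ^ r ≤ p ^ d` for `d ≤ r`, the attainment condition holds on the whole ball.
  · have hgr (X' : HierSmoothing.Data N D) (hX' : X' ∈ HierSmoothing.threatBall r ε X) :=
      HierSmoothing.isGreatest_feasibleProbs hp0 hp1 hσ X X' hf
        (hq.trans (pow_le_pow_of_le_one hp0.le hp1 hX'.1))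
    refine ⟨fun X' hX' => ?_, ?_, ?_⟩
    · rw [HierSmoothing.upperProb, (hgr X' hX').csSup_eq]
      exact hgr X' hX'
    · obtain ⟨X', h1, h2⟩ := HierSmoothing.exists_extremal_perturbation X hε' hr hrN hD
      have hX' : X' ∈ HierSmoothing.threatBall r ε X := ⟨h1.le, h2.le⟩
      refine ⟨X', hX', (hgr X' hX').csSup_eq.trans ?_⟩
      rw [h1, h2, mul_comm]
      rfl
    · rintro _ ⟨X', hX', rfl⟩
      refine (hgr X' hX').csSup_eq.trans_le ?_
      exact HierSmoothing.mul_gaussShift_div_add_mono measureReal_nonneg hP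
        (pow_le_pow_of_le_one hp0.le hp1 hX'.1) (div_le_div_of_nonneg_right hX'.2 hσ.le)
  · by_contra hne
    have hy := h (g X') hne
    have hm (y : Fin C) : MeasurableSet {Z | f Z = y} := hf (measurableSet_singleton y)
    have h1 := HierSmoothing.hierLaw_real_le_of_mem hp0 hp1 hσ hX' (hm (g X'))
    have h2 := HierSmoothing.le_hierLaw_real_of_mem hp0 hp1 hσ hX' (hm (g X))
    have h3 := hg X' (g X)
    rw [sub_eq_add_neg (HierSmoothing.normalQuantile _), ← EReal.coe_neg] at hy
    -- Scaled by `p ^ r`, the hypothesis separates the two bounds and contradicts the maximality of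
    -- `g X'` at `X'`.
    have h4 : (HierSmoothing.gaussShift (HierSmoothing.classProb p σ f X (g X') / p ^ r) (ε / σ) +
        (1 - p ^ r) / p ^ r) * p ^ r <
        HierSmoothing.gaussShift ((HierSmoothing.classProb p σ f X (g X) - (1 - p ^ r)) / p ^ r)
          (-(ε / σ)) * p ^ r := mul_lt_mul_of_pos_right hy hP
    rw [add_mul, div_mul_cancel₀ _ hP.ne'] at h4
    exact (h3.trans h1).not_gt (h4.trans_le h2)
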